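/- Let $(X,d)$ be an infinite compact metric space and let $0<\alpha<1$. For $f\in C(X)$ (complex-valued) and $x\neq y$ in $X$ put $\Delta f(x,y)=d(x,y)^{-\alpha}\,(f(x)-f(y))$ and $|f|_\alpha=\sup_{x\neq y}|\Delta f(x,y)|$. Let $\operatorname{lip}_\alpha(X,d)$ be the algebra, under pointwise operations, of all $f\in C(X)$ with $|f|_\alpha<\infty$ and $\Delta f(x,y)\to 0$ as $d(x,y)\to 0$, equipped with the norm $\|f\|=\|f\|_\infty+|f|_\alpha$; it is a commutative unital Banach algebra. Then $\operatorname{lip}_\alpha(X,d)$ is not approximately amenable. Here a Banach algebra $A$ is called approximately amenable if for every Banach $A$-bimodule $E$ and every continuous derivation $D:A\to E^*$ into the dual bimodule there is a net $(\xi_i)$ in $E^*$ such that $D(a)=\lim_i (a\cdot \xi_i-\xi_i\cdot a)$ in norm for every $a\in A$. -/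

import Mathlib

open Filter Topology

/-! ### Banach bimodules and approximate amenability -/

section Amenability

universe u v

/-- A Banach `A`-bimodule structure on the complex normed space `E`: a left and a right action
of `A`, both jointly continuous (bounded bilinear maps) and commuting with each other.
No unitality is required. `left a x` is `a · x` and `right a x` is `x · a`. -/
structure BanachBimodule (A : Type u) (E : Type v)
    [NonUnitalNormedRing A] [NormedSpace ℂ A] [NormedAddCommGroup E] [NormedSpace ℂ E] where
  left : A →L[ℂ] E →L[ℂ] E
  right : A →L[ℂ] E →L[ℂ] E
  left_mul : ∀ (a b : A) (x : E), left (a * b) x = left a (left b x)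
  right_mul : ∀ (a b : A) (x : E), right (a * b) x = right b (right a x)
  left_right : ∀ (a b : A) (x : E), left a (right b x) = right b (left a x)

namespace BanachBimodule

variable {A : Type u} {E : Type v}
  [NonUnitalNormedRing A] [NormedSpace ℂ A] [NormedAddCommGroup E] [NormedSpace ℂ E]

/-- The dual bimodule: on the space `E*` of bounded linear functionals with the operator norm,
`(a · φ) x = φ (x · a)` and `(φ · a) x = φ (a · x)`. -/
noncomputable def dual (B : BanachBimodule A E) : BanachBimodule A (E →L[ℂ] ℂ) where
  left := ((ContinuousLinearMap.compL ℂ E E ℂ).flip).comp B.right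
  right := ((ContinuousLinearMap.compL ℂ E E ℂ).flip).comp B.left
  left_mul a b φ := by
    ext x
    simp [B.right_mul]
  right_mul a b φ := by
    ext x
    simp [B.left_mul]
  left_right a b φ := by
    ext x
    simp [B.left_right]

theorem dual_left_apply (B : BanachBimodule A E) (a : A) (φ : E →L[ℂ] ℂ) (x : E) :
    B.dual.left a φ x = φ (B.right a x) := rfl

theorem dual_right_apply (B : BanachBimodule A E) (a : A) (φ : E →L[ℂ] ℂ) (x : E) :
    B.dual.right a φ x = φ (B.left a x) := rfl

/-- The continuous linear map `D : A → E` is a derivation: `D (ab) = a · D b + D a · b`. -/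
def IsDerivation (B : BanachBimodule A E) (D : A →L[ℂ] E) : Prop :=
  ∀ a b : A, D (a * b) = B.left a (D b) + B.right b (D a)

/-- The inner derivation `ad_x : a ↦ a · x - x · a`. -/
noncomputable def ad (B : BanachBimodule A E) (x : E) (a : A) : E :=
  B.left a x - B.right a x

/-- `D` is approximately inner: there is a net `(x_i)` in `E` such that `ad_{x_i} a → D a` in norm
for every `a`, that is, `D` is the limit of `(ad_{x_i})` in the strong operator topology. -/
def IsApproxInner (B : BanachBimodule A E) (D : A →L[ℂ] E) : Prop :=
  ∃ (ι : Type (max u v)) (_ : Preorder ι) (_ : IsDirectedOrder ι) (_ : Nonempty ι) (x : ι → E),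
    ∀ a : A, Tendsto (fun i => B.ad (x i) a) atTop (𝓝 (D a))

end BanachBimodule

/-- The Banach algebra `A` is approximately amenable: every continuous derivation from `A` into the
dual of any Banach `A`-bimodule is approximately inner. -/
def IsApproximatelyAmenable (A : Type u) [NonUnitalNormedRing A] [NormedSpace ℂ A]
    [IsScalarTower ℂ A A] [SMulCommClass ℂ A A] [CompleteSpace A] : Prop :=
  ∀ (E : Type u) [NormedAddCommGroup E] [NormedSpace ℂ E] [CompleteSpace E]
    (B : BanachBimodule A E) (D : A →L[ℂ] (E →L[ℂ] ℂ)),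
    B.dual.IsDerivation D → B.dual.IsApproxInner D

end Amenability

/-! ### Little Lipschitz algebras -/

section Lipschitz

variable {X : Type*} [MetricSpace X]

/-- `Δ f (x, y) = d(x, y)^{-α} (f x - f y)`, used for `x ≠ y`. -/
noncomputable def lipQuot (α : ℝ) (f : X → ℂ) (x y : X) : ℂ :=
  ((dist x y ^ (-α) : ℝ) : ℂ) * (f x - f y)

/-- The `α`-Lipschitz (Hölder) seminorm `sup_{x ≠ y} |Δ f (x, y)|`
(meaningful if the supremum is finite). -/
noncomputable def lipSeminorm (α : ℝ) (f : X → ℂ) : ℝ :=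
  ⨆ p : {p : X × X // p.1 ≠ p.2}, ‖lipQuot α f p.1.1 p.1.2‖

/-- `sup_{x ≠ y} |Δ f (x, y)| < ∞`. -/
def IsBigLip (α : ℝ) (f : X → ℂ) : Prop :=
  BddAbove (Set.range fun p : {p : X × X // p.1 ≠ p.2} => ‖lipQuot α f p.1.1 p.1.2‖)

/-- `Δ f (x, y) → 0` as `d(x, y) → 0`, for `x ≠ y`. -/
def LipQuotVanishes (α : ℝ) (f : X → ℂ) : Prop :=
  ∀ ε > 0, ∃ δ > 0, ∀ x y : X, x ≠ y → dist x y < δ → ‖lipQuot α f x y‖ < ε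

theorem lipQuot_add (α : ℝ) (f g : X → ℂ) (x y : X) :
    lipQuot α (f + g) x y = lipQuot α f x y + lipQuot α g x y := by
  simp only [lipQuot, Pi.add_apply]; ring

theorem lipQuot_smul (α : ℝ) (c : ℂ) (f : X → ℂ) (x y : X) :
    lipQuot α (c • f) x y = c * lipQuot α f x y := by
  simp only [lipQuot, Pi.smul_apply, smul_eq_mul]; ring

theorem lipQuot_mul (α : ℝ) (f g : X → ℂ) (x y : X) :
    lipQuot α (f * g) x y = lipQuot α f x y * g x + f y * lipQuot α g x y := by
  simp only [lipQuot, Pi.mul_apply]; ring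

theorem lipQuot_const (α : ℝ) (c : ℂ) (x y : X) :
    lipQuot α (fun _ => c) x y = 0 := by
  simp [lipQuot]

theorem isBigLip_iff (α : ℝ) (f : X → ℂ) :
    IsBigLip α f ↔ ∃ C : ℝ, ∀ x y : X, x ≠ y → ‖lipQuot α f x y‖ ≤ C := by
  constructor
  · rintro ⟨C, hC⟩
    exact ⟨C, fun x y h => hC ⟨⟨(x, y), h⟩, rfl⟩⟩
  · rintro ⟨C, hC⟩
    refine ⟨C, ?_⟩
    rintro _ ⟨p, rfl⟩
    exact hC _ _ p.2

theorem IsBigLip.le_lipSeminorm {α : ℝ} {f : X → ℂ} (hf : IsBigLip α f) {x y : X} (h : x ≠ y) :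
    ‖lipQuot α f x y‖ ≤ lipSeminorm α f :=
  le_ciSup hf (⟨(x, y), h⟩ : {p : X × X // p.1 ≠ p.2})

theorem lipSeminorm_le {α : ℝ} {f : X → ℂ} {C : ℝ} (hC : 0 ≤ C)
    (h : ∀ x y : X, x ≠ y → ‖lipQuot α f x y‖ ≤ C) : lipSeminorm α f ≤ C :=
  Real.iSup_le (fun p => h _ _ p.2) hC

theorem lipSeminorm_nonneg (α : ℝ) (f : X → ℂ) : 0 ≤ lipSeminorm α f :=
  Real.iSup_nonneg fun _ => norm_nonneg _

variable [CompactSpace X]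

variable (X) in
/-- The functions `f ∈ C(X)` with finite `α`-Lipschitz seminorm such that `Δ f (x, y) → 0` as
`d(x, y) → 0`, as a subalgebra of `C(X)`. -/
def lipSubalgebra (α : ℝ) : Subalgebra ℂ C(X, ℂ) where
  carrier := {f | IsBigLip α f ∧ LipQuotVanishes α f}
  mul_mem' := by
    rintro f g ⟨hf, hf'⟩ ⟨hg, hg'⟩
    have key : ∀ x y : X, ‖lipQuot α (⇑(f * g)) x y‖
        ≤ ‖lipQuot α f x y‖ * ‖g‖ + ‖f‖ * ‖lipQuot α g x y‖ := by
      intro x y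
      rw [ContinuousMap.coe_mul, lipQuot_mul]
      refine (norm_add_le _ _).trans ?_
      rw [norm_mul, norm_mul]
      gcongr
      · exact g.norm_coe_le_norm x
      · exact f.norm_coe_le_norm y
    constructor
    · rw [isBigLip_iff]
      refine ⟨lipSeminorm α f * ‖g‖ + ‖f‖ * lipSeminorm α g, fun x y h => (key x y).trans ?_⟩
      gcongr
      · exact hf.le_lipSeminorm h
      · exact hg.le_lipSeminorm h
    · intro ε hε
      have hM : 0 < ‖f‖ + ‖g‖ + 1 := by positivity
      obtain ⟨δ₁, hδ₁, h₁⟩ := hf' (ε / (‖f‖ + ‖g‖ + 1)) (by positivity)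
      obtain ⟨δ₂, hδ₂, h₂⟩ := hg' (ε / (‖f‖ + ‖g‖ + 1)) (by positivity)
      refine ⟨min δ₁ δ₂, lt_min hδ₁ hδ₂, fun x y h hd => ?_⟩
      have e₁ := h₁ x y h (hd.trans_le (min_le_left _ _))
      have e₂ := h₂ x y h (hd.trans_le (min_le_right _ _))
      have hη : 0 < ε / (‖f‖ + ‖g‖ + 1) := by positivity
      calc ‖lipQuot α (⇑(f * g)) x y‖
          ≤ ‖lipQuot α f x y‖ * ‖g‖ + ‖f‖ * ‖lipQuot α g x y‖ := key x y
        _ ≤ (ε / (‖f‖ + ‖g‖ + 1)) * ‖g‖ + ‖f‖ * (ε / (‖f‖ + ‖g‖ + 1)) := by gcongr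
        _ < (ε / (‖f‖ + ‖g‖ + 1)) * (‖f‖ + ‖g‖ + 1) := by nlinarith
        _ = ε := by field_simp
  add_mem' := by
    rintro f g ⟨hf, hf'⟩ ⟨hg, hg'⟩
    have key : ∀ x y : X, ‖lipQuot α (⇑(f + g)) x y‖
        ≤ ‖lipQuot α f x y‖ + ‖lipQuot α g x y‖ := by
      intro x y
      rw [ContinuousMap.coe_add, lipQuot_add]
      exact norm_add_le _ _
    constructor
    · rw [isBigLip_iff]
      exact ⟨lipSeminorm α f + lipSeminorm α g, fun x y h => (key x y).trans
        (add_le_add (hf.le_lipSeminorm h) (hg.le_lipSeminorm h))⟩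
    · intro ε hε
      obtain ⟨δ₁, hδ₁, h₁⟩ := hf' (ε / 2) (by positivity)
      obtain ⟨δ₂, hδ₂, h₂⟩ := hg' (ε / 2) (by positivity)
      refine ⟨min δ₁ δ₂, lt_min hδ₁ hδ₂, fun x y h hd => ?_⟩
      have e₁ := h₁ x y h (hd.trans_le (min_le_left _ _))
      have e₂ := h₂ x y h (hd.trans_le (min_le_right _ _))
      linarith [key x y]
  algebraMap_mem' c := by
    have key : ∀ x y : X, lipQuot α (⇑(algebraMap ℂ C(X, ℂ) c)) x y = 0 :=
      fun x y => lipQuot_const α c x y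
    constructor
    · rw [isBigLip_iff]
      exact ⟨0, fun x y _ => by rw [key, norm_zero]⟩
    · intro ε hε
      exact ⟨1, one_pos, fun x y _ _ => by rw [key, norm_zero]; exact hε⟩

variable (X) in
/-- The little Lipschitz algebra `lip_α(X, d)`, with pointwise operations and (below) the norm
`‖f‖_α = ‖f‖_∞ + sup_{x ≠ y} |Δ f (x, y)|`. -/
def LittleLip (α : ℝ) : Type _ := ↥(lipSubalgebra X α)

namespace LittleLip

variable {α : ℝ}

noncomputable instance instCommRing : CommRing (LittleLip X α) :=
  inferInstanceAs (CommRing ↥(lipSubalgebra X α))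

noncomputable instance instAlgebra : Algebra ℂ (LittleLip X α) :=
  inferInstanceAs (Algebra ℂ ↥(lipSubalgebra X α))

/-- The underlying continuous function, as an algebra homomorphism. -/
noncomputable def toC : LittleLip X α →ₐ[ℂ] C(X, ℂ) := (lipSubalgebra X α).val

theorem toC_injective : Function.Injective (toC : LittleLip X α → C(X, ℂ)) :=
  Subtype.val_injective

theorem isBigLip (f : LittleLip X α) : IsBigLip α (toC f) := f.2.1

theorem vanishes (f : LittleLip X α) : LipQuotVanishes α (toC f) := f.2.2

noncomputable instance instNorm : Norm (LittleLip X α) :=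
  ⟨fun f => ‖toC f‖ + lipSeminorm α (toC f)⟩

theorem norm_def (f : LittleLip X α) : ‖f‖ = ‖toC f‖ + lipSeminorm α (toC f) := rfl

theorem lipSeminorm_add_le (f g : LittleLip X α) :
    lipSeminorm α (toC (f + g)) ≤ lipSeminorm α (toC f) + lipSeminorm α (toC g) := by
  refine lipSeminorm_le (add_nonneg (lipSeminorm_nonneg _ _) (lipSeminorm_nonneg _ _)) ?_
  intro x y h
  rw [map_add, ContinuousMap.coe_add, lipQuot_add]
  exact (norm_add_le _ _).trans (add_le_add (f.isBigLip.le_lipSeminorm h)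
    (g.isBigLip.le_lipSeminorm h))

theorem lipSeminorm_smul_le (c : ℂ) (f : LittleLip X α) :
    lipSeminorm α (toC (c • f)) ≤ ‖c‖ * lipSeminorm α (toC f) := by
  refine lipSeminorm_le (mul_nonneg (norm_nonneg _) (lipSeminorm_nonneg _ _)) ?_
  intro x y h
  rw [map_smul, ContinuousMap.coe_smul, lipQuot_smul, norm_mul]
  gcongr
  exact f.isBigLip.le_lipSeminorm h

theorem norm_smul_le' (c : ℂ) (f : LittleLip X α) : ‖c • f‖ ≤ ‖c‖ * ‖f‖ := by
  rw [norm_def, norm_def, mul_add]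
  refine add_le_add ?_ (lipSeminorm_smul_le c f)
  rw [map_smul]
  exact norm_smul_le c _

theorem norm_mul_le' (f g : LittleLip X α) : ‖f * g‖ ≤ ‖f‖ * ‖g‖ := by
  have hf := lipSeminorm_nonneg α (toC f)
  have hg := lipSeminorm_nonneg α (toC g)
  have h₁ : ‖toC (f * g)‖ ≤ ‖toC f‖ * ‖toC g‖ := by
    rw [map_mul]
    exact norm_mul_le _ _
  have h₂ : lipSeminorm α (toC (f * g))
      ≤ lipSeminorm α (toC f) * ‖toC g‖ + ‖toC f‖ * lipSeminorm α (toC g) := by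
    refine lipSeminorm_le (by positivity) ?_
    intro x y h
    rw [map_mul, ContinuousMap.coe_mul, lipQuot_mul]
    refine (norm_add_le _ _).trans ?_
    rw [norm_mul, norm_mul]
    gcongr
    · exact f.isBigLip.le_lipSeminorm h
    · exact (toC g).norm_coe_le_norm x
    · exact (toC f).norm_coe_le_norm y
    · exact g.isBigLip.le_lipSeminorm h
  rw [norm_def, norm_def, norm_def]
  nlinarith [mul_nonneg hf hg]

noncomputable instance instNormedAddCommGroup : NormedAddCommGroup (LittleLip X α) :=
  AddGroupNorm.toNormedAddCommGroup
    { toFun := fun f => ‖f‖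
      map_zero' := by
        refine le_antisymm ?_ (add_nonneg (norm_nonneg _) (lipSeminorm_nonneg _ _))
        simpa using norm_smul_le' (0 : ℂ) (0 : LittleLip X α)
      add_le' := fun f g => by
        have h₁ : ‖toC (f + g)‖ ≤ ‖toC f‖ + ‖toC g‖ := by
          rw [map_add]
          exact norm_add_le _ _
        have h₂ := lipSeminorm_add_le f g
        rw [norm_def, norm_def, norm_def]
        linarith
      neg' := fun f => by
        have key : ∀ g : LittleLip X α, ‖-g‖ ≤ ‖g‖ := fun g => by
          simpa using norm_smul_le' (-1 : ℂ) g
        exact le_antisymm (key f) (by simpa using key (-f))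
      eq_zero_of_map_eq_zero' := fun f hf => by
        have h₀ := lipSeminorm_nonneg α (toC f)
        have h₁ := norm_nonneg (toC f)
        have h₂ : ‖toC f‖ + lipSeminorm α (toC f) = 0 := hf
        apply toC_injective
        rw [map_zero]
        exact norm_eq_zero.mp (by linarith) }

noncomputable instance instNormedCommRing : NormedCommRing (LittleLip X α) :=
  { instNormedAddCommGroup, instCommRing with
    norm_mul_le := norm_mul_le' }

noncomputable instance instNormedAlgebra : NormedAlgebra ℂ (LittleLip X α) :=
  { instAlgebra with
    norm_smul_le := norm_smul_le' }

theorem norm_toC_le (f : LittleLip X α) : ‖toC f‖ ≤ ‖f‖ := by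
  rw [norm_def]
  linarith [lipSeminorm_nonneg α (toC f)]

theorem norm_lipQuot_le (f : LittleLip X α) {x y : X} (h : x ≠ y) :
    ‖lipQuot α (toC f) x y‖ ≤ ‖f‖ := by
  rw [norm_def]
  linarith [f.isBigLip.le_lipSeminorm h, norm_nonneg (toC f)]

instance instCompleteSpace : CompleteSpace (LittleLip X α) := by
  refine Metric.complete_of_cauchySeq_tendsto fun u hu => ?_
  have hC : CauchySeq fun n => toC (u n) := by
    rw [Metric.cauchySeq_iff] at hu ⊢
    intro ε hε
    obtain ⟨N, hN⟩ := hu ε hε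
    refine ⟨N, fun m hm n hn => ?_⟩
    have := hN m hm n hn
    rw [dist_eq_norm] at this ⊢
    rw [← map_sub]
    exact (norm_toC_le _).trans_lt this
  obtain ⟨f, hf⟩ := cauchySeq_tendsto_of_complete hC
  have hpt : ∀ x : X, Tendsto (fun n => toC (u n) x) atTop (𝓝 (f x)) := fun x =>
    ((continuous_eval_const x).tendsto f).comp hf
  have hq : ∀ x y : X, Tendsto (fun n => lipQuot α (toC (u n)) x y) atTop
      (𝓝 (lipQuot α f x y)) := fun x y => ((hpt x).sub (hpt y)).const_mul _
  have hsub : ∀ (g h : X → ℂ) (x y : X),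
      lipQuot α (g - h) x y = lipQuot α g x y - lipQuot α h x y := by
    intro g h x y
    simp only [lipQuot, Pi.sub_apply]; ring
  have hunif : ∀ ε > 0, ∃ N, ∀ n ≥ N, ∀ x y : X, x ≠ y →
      ‖lipQuot α (toC (u n)) x y - lipQuot α f x y‖ ≤ ε := by
    intro ε hε
    obtain ⟨N, hN⟩ := Metric.cauchySeq_iff.mp hu ε hε
    refine ⟨N, fun n hn x y hxy => ?_⟩
    refine le_of_tendsto ((hq x y).const_sub _).norm ?_
    filter_upwards [eventually_ge_atTop N] with m hm
    have h₁ := norm_lipQuot_le (u n - u m) hxy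
    rw [map_sub, ContinuousMap.coe_sub, hsub] at h₁
    have h₂ := hN n hn m hm
    rw [dist_eq_norm] at h₂
    exact h₁.trans h₂.le
  have hmem : f ∈ lipSubalgebra X α := by
    constructor
    · rw [isBigLip_iff]
      obtain ⟨N, hN⟩ := hunif 1 one_pos
      refine ⟨‖u N‖ + 1, fun x y h => ?_⟩
      have h₁ := hN N le_rfl x y h
      have h₂ := norm_lipQuot_le (u N) h
      have h₃ := norm_sub_norm_le (lipQuot α f x y) (lipQuot α (toC (u N)) x y)
      rw [norm_sub_rev] at h₃
      linarith
    · intro ε hε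
      obtain ⟨N, hN⟩ := hunif (ε / 2) (by positivity)
      obtain ⟨δ, hδ, h⟩ := (u N).vanishes (ε / 2) (by positivity)
      refine ⟨δ, hδ, fun x y hxy hd => ?_⟩
      have h₁ := hN N le_rfl x y hxy
      have h₂ := h x y hxy hd
      have h₃ := norm_sub_norm_le (lipQuot α f x y) (lipQuot α (toC (u N)) x y)
      rw [norm_sub_rev] at h₃
      linarith
  let F : LittleLip X α := ⟨f, hmem⟩
  have hF : toC F = f := rfl
  refine ⟨F, ?_⟩
  rw [Metric.tendsto_atTop]
  intro ε hε
  obtain ⟨N₁, hN₁⟩ := hunif (ε / 2) (by positivity)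
  obtain ⟨N₂, hN₂⟩ := Metric.tendsto_atTop.mp hf (ε / 2) (by positivity)
  refine ⟨max N₁ N₂, fun n hn => ?_⟩
  have h₁ : lipSeminorm α (toC (u n - F)) ≤ ε / 2 := by
    refine lipSeminorm_le (by positivity) fun x y h => ?_
    rw [map_sub, ContinuousMap.coe_sub, hsub, hF]
    exact hN₁ n ((le_max_left _ _).trans hn) x y h
  have h₂ := hN₂ n ((le_max_right _ _).trans hn)
  rw [dist_eq_norm] at h₂ ⊢
  rw [norm_def]
  have h₃ : ‖toC (u n - F)‖ < ε / 2 := by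
    rw [map_sub, hF]
    exact h₂
  linarith

end LittleLip

end Lipschitz

/-! ### From approximate amenability to normalised approximate diagonals. -/

section ApproximateDiagonal

set_option maxSynthPendingDepth 3

universe u
variable {A : Type u} [NormedCommRing A] [NormedAlgebra ℂ A]

/-! Approximate amenability yields functionals `T` on pairs of functionals that nearly intertwine
multiplication by finitely many given elements in either variable, with error `ε ‖φ‖ ‖ψ‖`. Passing
to bilinear forms modulo `δ ⊗ δ` allows the exact normalisation `T δ δ = 1`
(`IsApproximatelyAmenable.exists_approximate_diagonal`).

Take `δ` to be evaluation at an accumulation point `x₀`, and let `p n → x₀` rapidly. Write `e x` for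
evaluation at `x` and `r n = d(p n, x₀) ^ α`, so that `‖e (p n) - e x₀‖ ≤ r n`. There are `a` and
`b` in the algebra, vanishing at `x₀`, with value `2 ^ (-n) r n` at `p n` for `n` even (for `a`) or
odd (for `b`), and `0` at the other `p n` (`LittleLip.exists_interpolating`). These values are
within a factor `2 ^ (-n)` of the largest size that the Hölder condition permits.

For `m` even and `n` odd, testing `T` on `e (p m) - e x₀` and `e (p n) - e x₀` with `a` shows that
`T (e (p m)) (e (p n))` is close to `T (e (p m)) (e x₀)`; with `b`, that it is close to `T (e x₀) (e
(p n))`. The interlaced sequence of these last two quantities therefore has geometrically small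
increments. It starts near `0` and tends to `T (e x₀) (e x₀) = 1`, but its total variation is too
small for that. -/

/-- Subtracting `B (1, 1) δ ⊗ δ` from the bilinear form `B`. -/
noncomputable def killCharacter (δ : A →L[ℂ] ℂ) :
    (A →L[ℂ] A →L[ℂ] ℂ) →L[ℂ] (A →L[ℂ] A →L[ℂ] ℂ) :=
  ContinuousLinearMap.id ℂ _ -
    (((ContinuousLinearMap.apply ℂ ℂ (1 : A)).comp
      (ContinuousLinearMap.apply ℂ (A →L[ℂ] ℂ) (1 : A))).smulRight (δ.smulRight δ))

theorem killCharacter_apply (δ : A →L[ℂ] ℂ) (B : A →L[ℂ] A →L[ℂ] ℂ) (f g : A) :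
    killCharacter δ B f g = B f g - B 1 1 * (δ f * δ g) := by
  simp [killCharacter]

/-- `(a, B) ↦ ((f, g) ↦ B (a f, g))`. -/
noncomputable def mulFst : A →L[ℂ] (A →L[ℂ] A →L[ℂ] ℂ) →L[ℂ] (A →L[ℂ] A →L[ℂ] ℂ) :=
  (ContinuousLinearMap.compL ℂ A A (A →L[ℂ] ℂ)).flip.comp (ContinuousLinearMap.mul ℂ A)

/-- `(a, B) ↦ ((f, g) ↦ B (f, a g))`. -/
noncomputable def mulSnd : A →L[ℂ] (A →L[ℂ] A →L[ℂ] ℂ) →L[ℂ] (A →L[ℂ] A →L[ℂ] ℂ) :=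
  (ContinuousLinearMap.compL ℂ A (A →L[ℂ] ℂ) (A →L[ℂ] ℂ)).comp
    ((ContinuousLinearMap.compL ℂ A A ℂ).flip.comp (ContinuousLinearMap.mul ℂ A))

theorem mulFst_apply (a : A) (B : A →L[ℂ] A →L[ℂ] ℂ) (f g : A) :
    mulFst a B f g = B (a * f) g := rfl

theorem mulSnd_apply (a : A) (B : A →L[ℂ] A →L[ℂ] ℂ) (f g : A) :
    mulSnd a B f g = B f (a * g) := rfl

/-- The bounded bilinear forms on `A` modulo the multiples of `δ ⊗ δ` for a character `δ`, realised
on the space of all bounded bilinear forms by composing the actions with `killCharacter δ`. -/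
noncomputable def bilinModule (δ : A →L[ℂ] ℂ) (hδ : ∀ a b, δ (a * b) = δ a * δ b) (h1 : δ 1 = 1) :
    BanachBimodule A (A →L[ℂ] A →L[ℂ] ℂ) where
  left := (ContinuousLinearMap.compL ℂ _ _ _ (killCharacter δ)).comp mulSnd
  right := (ContinuousLinearMap.compL ℂ _ _ _ (killCharacter δ)).comp mulFst
  -- Multiplication by `a` in one variable scales `δ ⊗ δ` by `δ a`, so it preserves the kernel of
  -- `killCharacter δ`. Hence an inner `killCharacter δ` is absorbed by the outer one, and the
  -- actions compose as on the quotient.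
  left_mul a b B := by
    ext f g
    simp [killCharacter_apply, mulSnd_apply, hδ, h1, mul_left_comm, mul_comm b a, mul_assoc]
    ring
  right_mul a b B := by
    ext f g
    simp [killCharacter_apply, mulFst_apply, hδ, h1, mul_left_comm, mul_assoc]
    ring
  left_right a b B := by
    ext f g
    simp [killCharacter_apply, mulFst_apply, mulSnd_apply, hδ, h1]
    ring

/-- `a ↦ (B ↦ B (a, 1) - B (1, a))`. -/
noncomputable def diagDerivation : A →L[ℂ] (A →L[ℂ] A →L[ℂ] ℂ) →L[ℂ] ℂ :=
  (ContinuousLinearMap.compL ℂ _ _ _ ((ContinuousLinearMap.apply ℂ ℂ (1 : A)).comp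
      (ContinuousLinearMap.apply ℂ (A →L[ℂ] ℂ) (1 : A)))).comp (mulFst - mulSnd)

theorem diagDerivation_apply (a : A) (B : A →L[ℂ] A →L[ℂ] ℂ) :
    diagDerivation a B = B a 1 - B 1 a := by
  simp [diagDerivation, mulFst_apply, mulSnd_apply]

/-- Without `killCharacter` this would be the inner derivation of `B ↦ B (1, 1)`. That functional is
`1` at `δ ⊗ δ` and does not descend to the quotient, whereas `B (a, 1) - B (1, a)` vanishes there
and does. -/
theorem isDerivation_diagDerivation (δ : A →L[ℂ] ℂ) (hδ : ∀ a b, δ (a * b) = δ a * δ b)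
    (h1 : δ 1 = 1) : (bilinModule δ hδ h1).dual.IsDerivation diagDerivation := by
  intro a b
  ext B
  rw [add_apply, BanachBimodule.dual_left_apply,
    BanachBimodule.dual_right_apply]
  simp only [diagDerivation_apply, bilinModule, ContinuousLinearMap.comp_apply,
    ContinuousLinearMap.compL_apply, killCharacter_apply, mulFst_apply, mulSnd_apply, h1, mul_one,
    mul_comm b a]
  ring

/-- An approximately amenable commutative unital Banach algebra has, for every character `δ`, every
finite set and every `ε`, an `ε`-approximate diagonal, normalised at `δ ⊗ δ`. It is given here by
its values on elementary tensors of functionals. -/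
theorem IsApproximatelyAmenable.exists_approximate_diagonal [CompleteSpace A]
    (hA : IsApproximatelyAmenable A) (δ : A →L[ℂ] ℂ) (hδ : ∀ a b, δ (a * b) = δ a * δ b)
    (h1 : δ 1 = 1) (S : Finset A) {ε : ℝ} (hε : 0 < ε) :
    ∃ T : (A →L[ℂ] ℂ) →L[ℂ] (A →L[ℂ] ℂ) →L[ℂ] ℂ, T δ δ = 1 ∧
      ∀ a ∈ S, ∀ φ ψ : A →L[ℂ] ℂ,
        ‖T (φ.comp (ContinuousLinearMap.mul ℂ A a)) ψ -
          T φ (ψ.comp (ContinuousLinearMap.mul ℂ A a))‖ ≤ ε * (‖φ‖ * ‖ψ‖) := by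
  obtain ⟨ι, _, _, _, x, hx⟩ := hA _ (bilinModule δ hδ h1) diagDerivation
    (isDerivation_diagDerivation δ hδ h1)
  have hev : ∀ᶠ i in atTop, ∀ a ∈ S,
      ‖(bilinModule δ hδ h1).dual.ad (x i) a - diagDerivation a‖ < ε := by
    rw [Filter.eventually_all_finset]
    intro a _
    have := Metric.tendsto_nhds.mp (hx a) ε hε
    simpa only [dist_eq_norm] using this
  obtain ⟨i, hi⟩ := hev.exists
  -- The correction by `x i` factors through `killCharacter δ`, so it leaves the value `1` at `δ ⊗
  -- δ` unchanged; elsewhere it nearly cancels the commutator of evaluation at `(1, 1)`.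
  let M : (A →L[ℂ] A →L[ℂ] ℂ) →L[ℂ] ℂ :=
    (ContinuousLinearMap.apply ℂ ℂ (1 : A)).comp
      (ContinuousLinearMap.apply ℂ (A →L[ℂ] ℂ) (1 : A)) - (x i).comp (killCharacter δ)
  have hM : ∀ B, M B = B 1 1 - x i (killCharacter δ B) := fun B => rfl
  refine ⟨(ContinuousLinearMap.compL ℂ _ _ _ M).comp
    (ContinuousLinearMap.smulRightL ℂ A (A →L[ℂ] ℂ)), ?_, fun a ha φ ψ => ?_⟩
  · have h0 : killCharacter δ (δ.smulRight δ) = 0 := by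
      ext f g
      simp [killCharacter_apply, h1]
    change M (δ.smulRight δ) = 1
    rw [hM, h0]
    simp [h1]
  · change ‖M ((φ.comp (ContinuousLinearMap.mul ℂ A a)).smulRight ψ) -
      M (φ.smulRight (ψ.comp (ContinuousLinearMap.mul ℂ A a)))‖ ≤ _
    have e₁ : (φ.comp (ContinuousLinearMap.mul ℂ A a)).smulRight ψ
        = mulFst a (φ.smulRight ψ) := rfl
    have e₂ : φ.smulRight (ψ.comp (ContinuousLinearMap.mul ℂ A a))
        = mulSnd a (φ.smulRight ψ) := rfl
    have key : M (mulFst a (φ.smulRight ψ)) - M (mulSnd a (φ.smulRight ψ))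
        = -((bilinModule δ hδ h1).dual.ad (x i) a - diagDerivation a) (φ.smulRight ψ) := by
      rw [hM, hM, sub_apply, diagDerivation_apply, BanachBimodule.ad,
        sub_apply, BanachBimodule.dual_left_apply,
        BanachBimodule.dual_right_apply, mulFst_apply, mulSnd_apply, mul_one]
      simp only [bilinModule, ContinuousLinearMap.comp_apply, ContinuousLinearMap.compL_apply]
      ring
    rw [e₁, e₂, key, norm_neg, ← ContinuousLinearMap.norm_smulRight_apply]
    exact (ContinuousLinearMap.le_opNorm _ _).trans
      (mul_le_mul_of_nonneg_right (hi a ha).le (norm_nonneg _))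

end ApproximateDiagonal

/-! ### Point evaluations, tent functions and interpolation in `lip_α`. -/

section LittleLip

theorem norm_lipQuot {X : Type*} [MetricSpace X] (α : ℝ) (f : X → ℂ) (x y : X) :
    ‖lipQuot α f x y‖ = dist x y ^ (-α) * ‖f x - f y‖ := by
  rw [lipQuot, norm_mul, Complex.norm_real, Real.norm_of_nonneg (by positivity)]

variable {X : Type*} [MetricSpace X] [CompactSpace X] {α : ℝ}

namespace LittleLip

/-- Evaluation at a point, as a bounded functional. -/
noncomputable def eval (x : X) : LittleLip X α →L[ℂ] ℂ :=
  LinearMap.mkContinuous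
    { toFun := fun f => toC f x
      map_add' := fun f g => by simp
      map_smul' := fun c f => by simp } 1
    fun f => by
      rw [one_mul]
      exact ((toC f).norm_coe_le_norm x).trans (norm_toC_le f)

theorem eval_apply (x : X) (f : LittleLip X α) : eval x f = toC f x := rfl

theorem norm_eval_le (x : X) : ‖(eval x : LittleLip X α →L[ℂ] ℂ)‖ ≤ 1 :=
  LinearMap.mkContinuous_norm_le _ zero_le_one _

theorem norm_eval_sub_eval_le (x y : X) :
    ‖(eval x - eval y : LittleLip X α →L[ℂ] ℂ)‖ ≤ dist x y ^ α := by
  refine ContinuousLinearMap.opNorm_le_bound _ (by positivity) fun f => ?_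
  rw [sub_apply, eval_apply, eval_apply]
  rcases eq_or_ne x y with rfl | h
  · rw [sub_self, norm_zero]
    positivity
  · have hd : 0 < dist x y := dist_pos.mpr h
    have hf := norm_lipQuot_le f h
    rw [norm_lipQuot, Real.rpow_neg hd.le, inv_mul_le_iff₀ (by positivity)] at hf
    exact hf

/-- A point evaluation is multiplicative, so it is an eigenvector of every multiplication operator
acting on the dual. -/
theorem eval_comp_mul (x : X) (a : LittleLip X α) :
    (eval x).comp (ContinuousLinearMap.mul ℂ _ a) = toC a x • eval x := by
  ext f
  simp [eval_apply]

theorem eval_comp_mul_of_eq_zero {x : X} {a : LittleLip X α} (ha : toC a x = 0) :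
    (eval x).comp (ContinuousLinearMap.mul ℂ _ a) = 0 := by
  ext f
  simp [eval_apply, ha]

/-- A Lipschitz function bounded by `1` with constant `L` belongs to `lip_α`, with norm at most
`1 + L ^ α`. -/
theorem exists_of_lipschitz (hα₀ : 0 < α) (hα₁ : α < 1) {τ : X → ℝ} {L : ℝ} (hL : 0 ≤ L)
    (h0 : ∀ x, 0 ≤ τ x) (h1 : ∀ x, τ x ≤ 1) (hτ : ∀ x y, |τ x - τ y| ≤ L * dist x y) :
    ∃ f : LittleLip X α, (∀ x, toC f x = τ x) ∧ ‖f‖ ≤ 1 + L ^ α := by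
  have hcont : Continuous τ :=
    (LipschitzWith.of_dist_le_mul (K := ⟨L, hL⟩) fun x y => hτ x y).continuous
  let F : C(X, ℂ) := ⟨fun x => (τ x : ℂ), Complex.continuous_ofReal.comp hcont⟩
  have hF : ∀ x y, ‖lipQuot α F x y‖ = dist x y ^ (-α) * |τ x - τ y| := by
    intro x y
    rw [norm_lipQuot, ← Real.norm_eq_abs, ← Complex.norm_real, Complex.ofReal_sub]
    rfl
  have hbig : ∀ x y, x ≠ y → ‖lipQuot α F x y‖ ≤ L ^ α := by
    intro x y h
    have hd : 0 < dist x y := dist_pos.mpr h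
    rw [hF, Real.rpow_neg hd.le, inv_mul_le_iff₀ (by positivity), mul_comm,
      ← Real.mul_rpow hL hd.le]
    -- With `t = L d(x, y)`, the increment is at most `min t 1`, and `min t 1 ≤ t ^ α` for `0 < α <
    -- 1`.
    rcases le_total (L * dist x y) 1 with hle | hle
    · exact (hτ x y).trans (Real.self_le_rpow_of_le_one (by positivity) hle hα₁.le)
    · refine le_trans ?_ (Real.one_le_rpow hle hα₀.le)
      rw [abs_le]
      constructor <;> linarith [h0 x, h0 y, h1 x, h1 y]
  have hvan : LipQuotVanishes α F := by
    intro ε hε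
    -- The quotient is at most `d ^ (-α) * (L d) = L d ^ (1 - α)`; this is where `α < 1` makes it
    -- vanish.
    have ht : Tendsto (fun t : ℝ => L * t ^ (1 - α)) (𝓝 0) (𝓝 0) := by
      have := ((Real.continuousAt_rpow_const (0 : ℝ) (1 - α) (Or.inr (by linarith))).tendsto).const_mul L
      rwa [Real.zero_rpow (by linarith), mul_zero] at this
    obtain ⟨δ, hδ, h⟩ := Metric.tendsto_nhds_nhds.mp ht ε hε
    refine ⟨δ, hδ, fun x y hxy hd => ?_⟩
    have hd0 : 0 < dist x y := dist_pos.mpr hxy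
    have h2 := h (x := dist x y) (by rwa [Real.dist_0_eq_abs, abs_of_pos hd0])
    rw [Real.dist_0_eq_abs, abs_of_nonneg (by positivity)] at h2
    refine lt_of_le_of_lt ?_ h2
    rw [hF, sub_eq_add_neg 1 α, Real.rpow_add hd0, Real.rpow_one, ← mul_assoc, mul_comm]
    exact mul_le_mul_of_nonneg_right (hτ x y) (by positivity)
  have hmem : F ∈ lipSubalgebra X α := ⟨(isBigLip_iff _ _).mpr ⟨_, hbig⟩, hvan⟩
  let f : LittleLip X α := ⟨F, hmem⟩
  refine ⟨f, fun x => rfl, ?_⟩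
  rw [norm_def]
  refine add_le_add ((ContinuousMap.norm_le _ zero_le_one).mpr fun x => ?_)
    (lipSeminorm_le (by positivity) hbig)
  change ‖(τ x : ℂ)‖ ≤ 1
  rw [Complex.norm_real, Real.norm_of_nonneg (h0 x)]
  exact h1 x

/-- The tent function of the distance to `x₀` with peak `1` at distance `ρ` and support in
distances between `ρ / 2` and `3 ρ / 2`. -/
theorem exists_tent (hα₀ : 0 < α) (hα₁ : α < 1) (x₀ : X) {ρ : ℝ} (hρ : 0 < ρ) :
    ∃ f : LittleLip X α,
      (∀ x, toC f x = (max 0 (1 - 2 / ρ * |dist x x₀ - ρ|) : ℝ)) ∧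
        ‖f‖ ≤ 1 + (2 / ρ) ^ α := by
  refine exists_of_lipschitz hα₀ hα₁ (by positivity) (fun x => le_max_left _ _)
    (fun x => max_le zero_le_one (by linarith [show 0 ≤ 2 / ρ * |dist x x₀ - ρ| by positivity])) ?_
  intro x y
  have h1 := abs_max_sub_max_le_abs (1 - 2 / ρ * |dist x x₀ - ρ|) (1 - 2 / ρ * |dist y x₀ - ρ|) 0
  rw [max_comm 0, max_comm 0]
  refine h1.trans ?_
  rw [sub_sub_sub_cancel_left, ← mul_sub, abs_mul, abs_of_pos (by positivity : 0 < 2 / ρ)]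
  gcongr
  calc |(|dist y x₀ - ρ| - |dist x x₀ - ρ|)| ≤ |(dist y x₀ - ρ) - (dist x x₀ - ρ)| :=
        abs_abs_sub_abs_le _ _
    _ = |dist y x₀ - dist x x₀| := by rw [sub_sub_sub_cancel_right]
    _ ≤ dist y x := abs_dist_sub_le _ _ _
    _ = dist x y := dist_comm _ _

/-- Interpolation along a sequence converging geometrically to `x₀`: the values
`2 ^ (-n) d (p n, x₀) ^ α` can be prescribed for `n` in `s`, and `0` for `n` outside `s`. -/
theorem exists_interpolating (hα₀ : 0 < α) (hα₁ : α < 1) {x₀ : X} {p : ℕ → X}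
    (hp : ∀ n, p n ≠ x₀) (hp2 : ∀ n, dist (p (n + 1)) x₀ ≤ dist (p n) x₀ / 2) (s : Set ℕ) :
    ∃ f : LittleLip X α, toC f x₀ = 0 ∧
      (∀ n ∈ s, toC f (p n) = ((1 / 2 : ℝ) ^ n * dist (p n) x₀ ^ α : ℝ)) ∧
      ∀ n ∉ s, toC f (p n) = 0 := by
  classical
  have hpos : ∀ n, 0 < dist (p n) x₀ := fun n => dist_pos.mpr (hp n)
  have hanti : Antitone fun n => dist (p n) x₀ :=
    antitone_nat_of_succ_le fun n => (hp2 n).trans (half_le_self (hpos n).le)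
  have hlt : ∀ m n, m < n → dist (p n) x₀ ≤ dist (p m) x₀ / 2 := fun m n h =>
    (hanti (Nat.succ_le_of_lt h)).trans (hp2 m)
  choose τ hτ hτn using fun n => exists_tent hα₀ hα₁ x₀ (hpos n)
  have hτself : ∀ n, toC (τ n) (p n) = 1 := by
    intro n
    rw [hτ]
    simp
  -- The distances to `x₀` at least halve at each step, so no other `p m` lies strictly between the
  -- radii `ρ / 2` and `3 ρ / 2` around `ρ = d(p n, x₀)`.
  have hτne : ∀ m n, m ≠ n → toC (τ n) (p m) = 0 := by
    intro m n hmn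
    rw [hτ, max_eq_left, Complex.ofReal_zero]
    rw [sub_nonpos, div_mul_eq_mul_div, le_div_iff₀ (hpos n), one_mul]
    rcases lt_or_gt_of_ne hmn with h | h
    · linarith [hlt _ _ h, hpos m, le_abs_self (dist (p m) x₀ - dist (p n) x₀)]
    · linarith [hlt _ _ h, neg_abs_le (dist (p m) x₀ - dist (p n) x₀)]
  have hτ0 : ∀ n, toC (τ n) x₀ = 0 := by
    intro n
    rw [hτ, max_eq_left, Complex.ofReal_zero]
    rw [dist_self, zero_sub, abs_neg, abs_of_pos (hpos n), div_mul_cancel₀ _ (hpos n).ne']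
    norm_num
  let c : ℕ → ℝ := fun n => if n ∈ s then (1 / 2 : ℝ) ^ n * dist (p n) x₀ ^ α else 0
  have hc0 : ∀ n, 0 ≤ c n := fun n => by
    simp only [c]
    split_ifs <;> positivity
  have hcle : ∀ n, c n ≤ (1 / 2 : ℝ) ^ n * dist (p n) x₀ ^ α := fun n => by
    simp only [c]
    split_ifs
    · exact le_rfl
    · positivity
  -- The tent at radius `ρ` has norm of order `ρ ^ (-α)`. The coefficient cancels this growth
  -- through `ρ ^ α`, and the factor `2 ^ (-n)` gives absolute convergence.
  have hsum : Summable fun n => (c n : ℂ) • τ n := by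
    refine Summable.of_norm_bounded
      (summable_geometric_two.mul_right (dist (p 0) x₀ ^ α + 2 ^ α)) fun n => ?_
    rw [norm_smul, Complex.norm_real, Real.norm_of_nonneg (hc0 n)]
    have hr : (0 : ℝ) < dist (p n) x₀ ^ α := Real.rpow_pos_of_pos (hpos n) _
    calc c n * ‖τ n‖
        ≤ ((1 / 2 : ℝ) ^ n * dist (p n) x₀ ^ α) * (1 + (2 / dist (p n) x₀) ^ α) := by
          gcongr
          · exact hcle n
          · exact hτn n
      _ = (1 / 2 : ℝ) ^ n * (dist (p n) x₀ ^ α + 2 ^ α) := by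
          rw [Real.div_rpow zero_le_two (hpos n).le]
          field_simp
      _ ≤ (1 / 2 : ℝ) ^ n * (dist (p 0) x₀ ^ α + 2 ^ α) := by
          gcongr
          exact hanti (Nat.zero_le n)
  have hval : ∀ x, toC (∑' n, (c n : ℂ) • τ n) x = ∑' n, (c n : ℂ) * toC (τ n) x := by
    intro x
    rw [← eval_apply, ContinuousLinearMap.map_tsum _ hsum]
    simp [eval_apply]
  have hval' : ∀ m, toC (∑' n, (c n : ℂ) • τ n) (p m) = c m := by
    intro m
    rw [hval, tsum_eq_single m fun n hn => by rw [hτne m n hn.symm, mul_zero], hτself, mul_one]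
  refine ⟨∑' n, (c n : ℂ) • τ n, ?_, fun n hn => ?_, fun n hn => ?_⟩
  · rw [hval]
    simp [hτ0]
  · rw [hval']
    simp only [c, if_pos hn]
  · rw [hval']
    simp only [c, if_neg hn, Complex.ofReal_zero]

end LittleLip

/-- An infinite compact metric space contains a sequence converging rapidly to a point off it. -/
theorem exists_rapidly_converging_seq [Infinite X] (hα₀ : 0 < α) :
    ∃ (x₀ : X) (p : ℕ → X), (∀ n, p n ≠ x₀) ∧
      (∀ n, dist (p (n + 1)) x₀ ≤ dist (p n) x₀ / 2) ∧
      ∀ n, dist (p n) x₀ ^ α ≤ (1 / 4 : ℝ) ^ n := by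
  obtain ⟨x₀, hx₀⟩ : ∃ x₀ : X, (𝓝[≠] x₀).NeBot := by
    obtain ⟨x, hx⟩ := (Set.infinite_univ (α := X)).exists_accPt_principal
    exact ⟨x, by simpa [AccPt] using hx⟩
  have key : ∀ ε > 0, ∃ y, y ≠ x₀ ∧ dist y x₀ < ε := by
    intro ε hε
    obtain ⟨y, hy⟩ := (hx₀.nonempty_of_mem (inter_mem self_mem_nhdsWithin
      (mem_nhdsWithin_of_mem_nhds (Metric.ball_mem_nhds x₀ hε))))
    exact ⟨y, hy.1, hy.2⟩
  have step : ∀ ε : {e : ℝ // 0 < e}, ∃ y, y ≠ x₀ ∧ dist y x₀ < ε := fun ε => key ε ε.2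
  choose g hg0 hg using step
  -- Chosen so that `b n ^ α = 4 ^ (-n)`.
  let b : ℕ → ℝ := fun n => ((1 / 4 : ℝ) ^ n) ^ α⁻¹
  have hb : ∀ n, 0 < b n := fun n => by positivity
  let q : ℕ → {y : X // y ≠ x₀} := fun n => Nat.rec ⟨g ⟨b 0, hb 0⟩, hg0 _⟩
    (fun n y => ⟨g ⟨min (b (n + 1)) (dist y.1 x₀ / 2),
      lt_min (hb _) (half_pos (dist_pos.mpr y.2))⟩, hg0 _⟩) n
  refine ⟨x₀, fun n => (q n).1, fun n => (q n).2, fun n => ?_, fun n => ?_⟩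
  · exact ((hg _).trans_le (min_le_right _ _)).le
  · have hqb : dist (q n).1 x₀ ≤ b n := by
      cases n with
      | zero => exact (hg _).le
      | succ n => exact ((hg _).trans_le (min_le_left _ _)).le
    calc dist (q n).1 x₀ ^ α ≤ b n ^ α := by gcongr
      _ = (1 / 4 : ℝ) ^ n := Real.rpow_inv_rpow (by positivity) hα₀.ne'

end LittleLip

/-! ### The contradiction. -/

/-- A sequence whose increments are bounded by `C 2 ^ (-n)` stays within `2 C` of its limit. -/
theorem norm_sub_le_of_geometric {u : ℕ → ℂ} {l : ℂ} {C : ℝ}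
    (hu : ∀ n, ‖u n - u (n + 1)‖ ≤ C * (1 / 2) ^ n) (hl : Tendsto u atTop (𝓝 l)) :
    ‖u 0 - l‖ ≤ 2 * C := by
  have := dist_le_of_le_geometric_of_tendsto₀ (1 / 2) C (by norm_num)
    (fun n => by rw [dist_eq_norm]; exact hu n) hl
  rw [dist_eq_norm] at this
  norm_num at this
  linarith

theorem theorem3p3 {X : Type*} [MetricSpace X] [CompactSpace X] [Infinite X]
    (α : ℝ) (hα₀ : 0 < α) (hα₁ : α < 1) :
    ¬ IsApproximatelyAmenable (LittleLip X α) := by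
  intro hA
  classical
  obtain ⟨x₀, p, hp, hp2, hp4⟩ := exists_rapidly_converging_seq (X := X) hα₀
  obtain ⟨a, ha0, has, han⟩ := LittleLip.exists_interpolating hα₀ hα₁ hp hp2 {n | Even n}
  obtain ⟨b, hb0, hbs, hbn⟩ := LittleLip.exists_interpolating hα₀ hα₁ hp hp2 {n | ¬ Even n}
  obtain ⟨T, hT1, hT⟩ := hA.exists_approximate_diagonal (LittleLip.eval x₀)
    (fun f g => by simp [LittleLip.eval_apply]) (by simp [LittleLip.eval_apply])
    {a, b} (ε := 1 / 8) (by norm_num)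
  let e : X → LittleLip X α →L[ℂ] ℂ := LittleLip.eval
  let r : ℕ → ℝ := fun n => dist (p n) x₀ ^ α
  have hr : ∀ n, 0 < r n := fun n => Real.rpow_pos_of_pos (dist_pos.mpr (hp n)) _
  have hr4 : ∀ n, r n ≤ (1 / 4 : ℝ) ^ n := hp4
  have hT1 : T (e x₀) (e x₀) = 1 := hT1
  have hen : ∀ n, ‖e (p n) - e x₀‖ ≤ r n := fun n => LittleLip.norm_eval_sub_eval_le _ _
  have he1 : ∀ x, ‖e x‖ ≤ 1 := LittleLip.norm_eval_le
  -- As `f` vanishes at `x₀`, multiplying the short functional `e (p n) - e x₀` by `f` leaves only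
  -- the term at `p n`.
  have hmul : ∀ (f : LittleLip X α) n, LittleLip.toC f x₀ = 0 →
      (e (p n) - e x₀).comp (ContinuousLinearMap.mul ℂ _ f)
        = LittleLip.toC f (p n) • e (p n) := by
    intro f n hf
    rw [ContinuousLinearMap.sub_comp, LittleLip.eval_comp_mul,
      LittleLip.eval_comp_mul_of_eq_zero hf, sub_zero]
  have hmul0 : ∀ f : LittleLip X α, LittleLip.toC f x₀ = 0 →
      (e x₀).comp (ContinuousLinearMap.mul ℂ _ f) = 0 :=
    fun f hf => LittleLip.eval_comp_mul_of_eq_zero hf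
  have hpair : ∀ f ∈ ({a, b} : Finset (LittleLip X α)), LittleLip.toC f x₀ = 0 → ∀ m n,
      ‖LittleLip.toC f (p m) * (T (e (p m)) (e (p n)) - T (e (p m)) (e x₀)) -
        LittleLip.toC f (p n) * (T (e (p m)) (e (p n)) - T (e x₀) (e (p n)))‖
        ≤ 1 / 8 * (r m * r n) := by
    intro f hf hf0 m n
    have h := hT f hf (e (p m) - e x₀) (e (p n) - e x₀)
    rw [hmul f m hf0, hmul f n hf0] at h
    simp only [map_sub, map_smul, sub_apply, smul_apply,
      smul_eq_mul] at h
    rw [mul_sub, mul_sub]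
    rw [mul_sub] at h
    refine h.trans ?_
    gcongr
    · exact hen m
    · exact hen n
  -- Dividing by the prescribed value `2 ^ (-m) r m` cancels `r m` and costs only `2 ^ m`, which the
  -- decay `r n ≤ 4 ^ (-n)` can absorb.
  have hcancel : ∀ (m n : ℕ) (z : ℂ),
      ‖(((1 / 2 : ℝ) ^ m * r m : ℝ) : ℂ) * z‖ ≤ 1 / 8 * (r m * r n) →
        ‖z‖ ≤ 1 / 8 * (2 ^ m * r n) := by
    intro m n z h
    rw [norm_mul, Complex.norm_real, Real.norm_of_nonneg (by have := hr m; positivity), one_div,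
      inv_pow, ← one_div, one_div_mul_eq_div, div_mul_eq_mul_div, div_le_iff₀ (by positivity)] at h
    have := hr m
    refine le_of_mul_le_mul_left (h.trans_eq ?_) this
    ring
  have hclose : ∀ m n, Even m → ¬ Even n →
      ‖T (e (p m)) (e x₀) - T (e x₀) (e (p n))‖ ≤ 1 / 8 * (2 ^ m * r n + 2 ^ n * r m) := by
    intro m n hm hn
    have h1 := hpair a (by simp) ha0 m n
    rw [han n (by simpa using hn), has m hm, zero_mul, sub_zero] at h1
    have h2 := hpair b (by simp) hb0 m n
    rw [hbn m (by simpa using hm), hbs n hn, zero_mul, zero_sub, norm_neg, mul_comm (r m)] at h2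
    have h1' := hcancel m n _ h1
    have h2' := hcancel n m _ h2
    have h3 := norm_sub_le (T (e (p m)) (e (p n)) - T (e x₀) (e (p n)))
      (T (e (p m)) (e (p n)) - T (e (p m)) (e x₀))
    rw [sub_sub_sub_cancel_left] at h3
    linarith
  -- Consecutive indices have opposite parity, so `hclose` controls every increment of this
  -- interlaced sequence.
  let μ : ℕ → ℂ := fun n => if Even n then T (e (p n)) (e x₀) else T (e x₀) (e (p n))
  have hstep : ∀ n, ‖μ n - μ (n + 1)‖ ≤ 3 / 8 * (1 / 2) ^ n := by
    intro n
    have hbound : 1 / 8 * (2 ^ n * r (n + 1) + 2 ^ (n + 1) * r n) ≤ 3 / 8 * (1 / 2) ^ n := by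
      have e1 : (2 : ℝ) ^ n * (1 / 4) ^ n = (1 / 2) ^ n := by
        rw [← mul_pow]
        norm_num
      have i1 : (2 : ℝ) ^ n * r n ≤ (1 / 2) ^ n := by
        rw [← e1]
        gcongr
        exact hr4 n
      have i2 : (2 : ℝ) ^ n * r (n + 1) ≤ (1 / 2) ^ n := by
        rw [← e1]
        gcongr
        exact (hr4 (n + 1)).trans (pow_le_pow_of_le_one (by norm_num) (by norm_num) n.le_succ)
      rw [pow_succ]
      linarith
    by_cases h : Even n
    · have h' : ¬ Even (n + 1) := by simpa [Nat.even_add_one] using h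
      simp only [μ, if_pos h, if_neg h']
      exact (hclose n (n + 1) h h').trans hbound
    · have h' : Even (n + 1) := by simpa [Nat.even_add_one] using h
      simp only [μ, if_neg h, if_pos h']
      rw [norm_sub_rev]
      refine (hclose (n + 1) n h' h).trans (le_trans (le_of_eq ?_) hbound)
      ring
  have hr0 : Tendsto r atTop (𝓝 0) :=
    squeeze_zero (fun n => (hr n).le) hr4
      (tendsto_pow_atTop_nhds_zero_of_lt_one (by norm_num) (by norm_num))
  have he : Tendsto (fun n => e (p n)) atTop (𝓝 (e x₀)) := by
    rw [tendsto_iff_norm_sub_tendsto_zero]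
    exact squeeze_zero (fun n => norm_nonneg _) hen hr0
  have hlim : Tendsto μ atTop (𝓝 1) := by
    have l1 : Tendsto (fun n => T (e (p n)) (e x₀)) atTop (𝓝 1) := by
      rw [← hT1]
      exact ((T.flip (e x₀)).continuous.tendsto (e x₀)).comp he
    have l2 : Tendsto (fun n => T (e x₀) (e (p n))) atTop (𝓝 1) := by
      rw [← hT1]
      exact ((T (e x₀)).continuous.tendsto (e x₀)).comp he
    exact l1.if' l2
  -- The second functional is now `e x₀` itself, which `a` annihilates. Only `a (p 0) = r 0` times
  -- `μ 0` remains, bounded by `r 0 / 8`.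
  have hμ0 : ‖μ 0‖ ≤ 1 / 8 := by
    have h := hT a (by simp) (e (p 0) - e x₀) (e x₀)
    rw [hmul a 0 ha0, hmul0 a ha0, has 0 (by simp), map_zero, sub_zero, map_smul,
      smul_apply, smul_eq_mul, pow_zero, one_mul, norm_mul, Complex.norm_real,
      Real.norm_of_nonneg (hr 0).le] at h
    have h' : r 0 * ‖T (e (p 0)) (e x₀)‖ ≤ r 0 * (1 / 8) := by
      refine h.trans ?_
      have := mul_le_mul (hen 0) (he1 x₀) (norm_nonneg _) (hr 0).le
      linarith
    simpa [μ] using le_of_mul_le_mul_left h' (hr 0)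
  have h1 := norm_sub_le_of_geometric hstep hlim
  have h2 := norm_sub_norm_le 1 (μ 0)
  rw [norm_one, norm_sub_rev] at h2
  -- The bounds would give `1 ≤ 1 / 8 + 2 * (3 / 8) = 7 / 8`, which is why the tolerance `1 / 8`
  -- suffices.
  linarith
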